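/- All maps are continuous; $X$, $X'$, $Y$ are Hausdorff, connected and locally path connected, $Y$ is semilocally simply connected, and $\emptyset\ne B\subset Y$. Definitions. For a map $f\colon X\to Y$, points $x_0,x_1\in f^{-1}(B)$ are Nielsen equivalent if there are a path $\alpha$ in $X$ from $x_0$ to $x_1$ and a path $\beta$ in $B$ from $f(x_0)$ to $f(x_1)$ such that $f\alpha\sim\beta$ in $Y$ relative to end points; the equivalence classes are the Nielsen classes of $f$. For a homotopy $\{f_t\}\colon X\to Y$, a Nielsen class $A_0$ of $f_0$ is $\{f_t\}$-related to a Nielsen class $A_1$ of $f_1$ if there are $x_0\in A_0$, $x_1\in A_1$, a path $\alpha$ in $X$ from $x_0$ to $x_1$ and a path $\beta$ in $B$ from $f_0(x_0)$ to $f_1(x_1)$ such that the path $t\mapsto f_t(\alpha(t))$ is homotopic to $\beta$ in $Y$ relative to end points. A Nielsen class $A$ of $f$ is essential if for every homotopy $\{f_t\}$ with $f_0=f$ some Nielsen class of $f_1$ is $\{f_t\}$-related to $A$. $\mathrm N_t(f,B)\in\{0,1,2,\dots,\infty\}$ is the number of essential Nielsen classes of $f$. A Hopf covering and a Hopf lift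 for $f$ are a connected covering $p\colon\hat Y\to Y$ and a lift $\hat f\colon X\to\hat Y$ of $f$ through $p$ with $p_\#\pi_1(\hat Y,\hat f(x))=f_\#\pi_1(X,x)$ for every $x\in X$. The $\mathcal R$-sets of $(f,\hat f)$ are the sets $\hat f^{-1}(\hat B)$, possibly empty, one for each path component $\hat B$ of $p^{-1}(B)$, and each is labelled by its $\hat B$; they form $\mathcal R(f,\hat f)$. Lemma. Let $f\colon X\to Y$, $f'\colon X'\to Y$ and $\varphi\colon X\to X'$ be maps with $f=f'\varphi$. (1) Suppose that $\varphi_\#\colon\pi_1(X,x_0)\to\pi_1(X',\varphi(x_0))$ is surjective for some $x_0\in X$. Then: (1.1) If $p'\colon\hat Y'\to Y$ and $\hat f'$ are a Hopf covering and a Hopf lift for $f'$, then $p'$ and $\hat f'\varphi$ are a Hopf covering and a Hopf lift for $f$. (1.2) Let $(p\colon\hat Y\to Y,\ \hat f)$ and $(p'\colon\hat Y'\to Y,\ \hat f')$ be any Hopf coverings and lifts for $f$ and $f'$ (for example $p=p'$, $\hat f=\hat f'\varphi$). There is exactly one map $q\colon\hat Y\to\hat Y'$ with $p=p'q$ and $q\hat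 f=\hat f'\varphi$, and the map $\mathcal R(f,\hat f)\to\mathcal R(f',\hat f')$ that sends the $\mathcal R$-set labelled by $\hat B$ to the one labelled by the path component of $p'^{-1}(B)$ containing $q(\hat B)$ is injective. (1.3) The map in (1.2) sends essential classes of $f$ to essential classes of $f'$. Moreover $\mathrm N_t(f,B)\le \mathrm N_t(f',B)$. (2) Suppose that $\varphi$ has a right homotopy inverse $\chi\colon X'\to X$, that is, $\varphi\chi\sim\mathrm{id}_{X'}$. If $g\sim f$ is a map all of whose Nielsen classes are essential, then $g\chi\sim f'$ and all Nielsen classes of $g\chi$ are essential. Moreover (whether or not such a $g$ exists) $\mathrm N_t(f,B)=\mathrm N_t(f',B)$. -/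

import Mathlib

open Topology

universe u u' w v v'

namespace NielsenPreimage

/-- Every point of `Y` has a neighbourhood in which all loops at that point are
null-homotopic in `Y`. -/
def SemilocallySimplyConnected (Y : Type*) [TopologicalSpace Y] : Prop :=
  ∀ y : Y, ∃ U ∈ 𝓝 y, ∀ γ : Path y y, (∀ t, γ t ∈ U) → γ.Homotopic (Path.refl y)

section Classes

variable {X Y : Type*} [TopologicalSpace X] [TopologicalSpace Y]

/-- Nielsen equivalence of points of `f ⁻¹(B)`: there are a path `α` in `X` from `x₀` to `x₁` and
a path `β` in `B` from `f x₀` to `f x₁` such that `f α` and `β` are homotopic in `Y` relative to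
end points. (The endpoints of `β` lie in `B`, so `x₀` and `x₁` lie in `f ⁻¹(B)`.) -/
def NielsenEquiv (f : C(X, Y)) (B : Set Y) (x₀ x₁ : X) : Prop :=
  ∃ (α : Path x₀ x₁) (β : Path (f x₀) (f x₁)),
    (∀ t, β t ∈ B) ∧ (α.map f.continuous).Homotopic β

/-- The path `t ↦ f_t (α t)` for a homotopy `{f_t}` and a path `α`. -/
def diagPath {f₀ f₁ : C(X, Y)} (F : f₀.Homotopy f₁) {x₀ x₁ : X} (α : Path x₀ x₁) :
    Path (f₀ x₀) (f₁ x₁) where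
  toFun t := F (t, α t)
  continuous_toFun := by fun_prop
  source' := by simp
  target' := by simp

/-- `x₀ ∈ f₀ ⁻¹(B)` is `{f_t}`-related to `x₁ ∈ f₁ ⁻¹(B)`. -/
def Related {f₀ f₁ : C(X, Y)} (F : f₀.Homotopy f₁) (B : Set Y) (x₀ x₁ : X) : Prop :=
  ∃ (α : Path x₀ x₁) (β : Path (f₀ x₀) (f₁ x₁)),
    (∀ t, β t ∈ B) ∧ (diagPath F α).Homotopic β

/-- `A` is a Nielsen class of `f : X → Y ⊃ B`, i.e. an equivalence class of points of
`f ⁻¹(B)`. -/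
def IsNielsenClass (f : C(X, Y)) (B : Set Y) (A : Set X) : Prop :=
  ∃ x₀ ∈ f ⁻¹' B, A = {x | NielsenEquiv f B x₀ x}

/-- The class `A₀` of `f₀` is `{f_t}`-related to the class `A₁` of `f₁`. -/
def ClassRelated {f₀ f₁ : C(X, Y)} (F : f₀.Homotopy f₁) (B : Set Y) (A₀ A₁ : Set X) : Prop :=
  ∃ x₀ ∈ A₀, ∃ x₁ ∈ A₁, Related F B x₀ x₁

/-- `A` is a topologically essential Nielsen class of `f : X → Y ⊃ B`: no homotopy beginning at
`f` deletes it. -/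
def IsEssentialClass (f : C(X, Y)) (B : Set Y) (A : Set X) : Prop :=
  IsNielsenClass f B A ∧
    ∀ (f₁ : C(X, Y)) (F : f.Homotopy f₁), ∃ A₁, IsNielsenClass f₁ B A₁ ∧ ClassRelated F B A A₁

/-- All Nielsen classes of `f : X → Y ⊃ B` are topologically essential. -/
def AllClassesEssential (f : C(X, Y)) (B : Set Y) : Prop :=
  ∀ A, IsNielsenClass f B A → IsEssentialClass f B A

/-- The topological Nielsen number, an integer or infinity. -/
noncomputable def nielsenNumber (f : C(X, Y)) (B : Set Y) : ℕ∞ :=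
  {A : Set X | IsEssentialClass f B A}.encard

end Classes

section Hopf

variable {X Y E : Type*} [TopologicalSpace X] [TopologicalSpace Y] [TopologicalSpace E]

/-- `p : E → Y` is a Hopf covering for `f : X → Y` and `fhat : X → E` is a Hopf lift: `p` is a
connected covering, `fhat` is a lift of `f`, and `p_# π₁(E, fhat x) = f_# π₁(X, x)` as subgroups
of `π₁(Y, f x)`, for each `x`. -/
structure IsHopf (f : C(X, Y)) (p : C(E, Y)) (fhat : C(X, E)) : Prop where
  connected : ConnectedSpace E
  covering : IsCoveringMap p
  lift : ∀ x, p (fhat x) = f x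
  range_eq : ∀ x, (FundamentalGroup.mapOfEq p (lift x)).range = (FundamentalGroup.map f x).range

/-- The `R`-sets of a map with lift `fhat` through `p`: one for each path component of
`p ⁻¹(B)`, which is its label. -/
@[ext]
structure RSet (p : C(E, Y)) (fhat : C(X, E)) (B : Set Y) where
  label : ZerothHomotopy (p ⁻¹' B)

/-- The underlying subset of `X` of an `R`-set: the preimage under `fhat` of its label. -/
def RSet.carrier {p : C(E, Y)} {fhat : C(X, E)} {B : Set Y} (R : RSet p fhat B) : Set X :=
  {x | ∃ h : fhat x ∈ p ⁻¹' B, ZerothHomotopy.mk (⟨fhat x, h⟩ : p ⁻¹' B) = R.label}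

end Hopf

section Comparison

variable {X X' Y E E' : Type*} [TopologicalSpace X] [TopologicalSpace X'] [TopologicalSpace Y]
  [TopologicalSpace E] [TopologicalSpace E']

/-- `q : E → E'` is compatible with the coverings `p`, `p'` of `Y` and with the lifts
`fhat`, `fhat'`: `p = p' q` and `q fhat = fhat' φ`. -/
structure IsComparison (φ : C(X, X')) (p : C(E, Y)) (fhat : C(X, E)) (p' : C(E', Y))
    (fhat' : C(X', E')) (q : C(E, E')) : Prop where
  proj : ∀ e, p' (q e) = p e
  lift : ∀ x, q (fhat x) = fhat' (φ x)

variable {φ : C(X, X')} {p : C(E, Y)} {fhat : C(X, E)} {p' : C(E', Y)} {fhat' : C(X', E')}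
  {q : C(E, E')}

/-- The restriction `p ⁻¹(B) → p' ⁻¹(B)` of `q`. -/
def IsComparison.restrict (hq : IsComparison φ p fhat p' fhat' q) (B : Set Y) :
    C(p ⁻¹' B, p' ⁻¹' B) where
  toFun e := ⟨q e, (congrArg (· ∈ B) (hq.proj e)).mpr e.2⟩
  continuous_toFun := by fun_prop

/-- The map of `R`-sets that sends the `R`-set labelled by a path component `C` of `p ⁻¹(B)` to
the one labelled by the path component of `p' ⁻¹(B)` that contains `q C`. -/
def IsComparison.rsetMap (hq : IsComparison φ p fhat p' fhat' q) (B : Set Y)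
    (R : RSet p fhat B) : RSet p' fhat' B where
  label := ZerothHomotopy.lift (fun e => ZerothHomotopy.mk (hq.restrict B e))
    (fun _ _ γ => ZerothHomotopy.sound (γ.map (hq.restrict B).continuous)) R.label

end Comparison

end NielsenPreimage

/-! Everything is computed with homotopy classes of paths. Points x, y are Nielsen equivalent when
some class a from x to y has an f-image containing a path in B; for a relation along a homotopy F,
the track of F at y is appended to the image of a. Naturality of tracks gives all the calculus, and
essentiality can be tested at a single point of a class. A homotopy of f' composed with φ is a
homotopy of f'φ, so φ carries essential points to essential points (`IsEssentialPoint.map`). If φ is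
surjective on π₁, every class from φ x to φ y comes from one from x to y, so φ reflects Nielsen
equivalence and N(f) ≤ N(f'). On Hopf coverings, equality of the two π₁-images makes q invertible
from the left. If φχ ~ id, then φ is surjective on π₁; conversely f' ~ f'φχ, and χ injects the
essential classes of f'φχ into those of f'φ. For g ~ f'φ, a homotopy of gχ is tested against g by
prefixing a homotopy from g to gχφ (`isEssentialPoint_comp_rightInverse`). -/

namespace Path.Homotopic.Quotient

variable {X Y : Type*} [TopologicalSpace X] [TopologicalSpace Y] {x y z : X}

theorem map_trans (a : Path.Homotopic.Quotient x y) (b : Path.Homotopic.Quotient y z)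
    (f : C(X, Y)) : (a.trans b).map f = (a.map f).trans (b.map f) := by
  induction a using Path.Homotopic.Quotient.ind
  induction b using Path.Homotopic.Quotient.ind
  simp only [← mk_trans, ← mk_map, Path.map_trans]

theorem map_symm (a : Path.Homotopic.Quotient x y) (f : C(X, Y)) :
    a.symm.map f = (a.map f).symm := by
  induction a using Path.Homotopic.Quotient.ind
  rfl

theorem map_id (a : Path.Homotopic.Quotient x y) : a.map (ContinuousMap.id X) = a := by
  induction a using Path.Homotopic.Quotient.ind
  rfl

theorem trans_symm_trans (a : Path.Homotopic.Quotient x y) (b : Path.Homotopic.Quotient x z) :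
    a.trans (a.symm.trans b) = b := by
  rw [← trans_assoc, trans_symm, refl_trans]

theorem symm_trans_trans (a : Path.Homotopic.Quotient x y) (b : Path.Homotopic.Quotient y z) :
    a.symm.trans (a.trans b) = b := by
  rw [← trans_assoc, symm_trans, refl_trans]

theorem trans_left_cancel (a : Path.Homotopic.Quotient x y) {b c : Path.Homotopic.Quotient y z}
    (h : a.trans b = a.trans c) : b = c := by
  rw [← symm_trans_trans a b, h, symm_trans_trans]

theorem trans_right_cancel (c : Path.Homotopic.Quotient y z) {a b : Path.Homotopic.Quotient x y}
    (h : a.trans c = b.trans c) : a = b := by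
  rw [← trans_refl a, ← trans_refl b, ← trans_symm c, ← trans_assoc, h, trans_assoc]

/-- The homotopy class contains a path in `B`. -/
def HasRepIn (B : Set X) (a : Path.Homotopic.Quotient x y) : Prop :=
  ∃ β : Path x y, (∀ t, β t ∈ B) ∧ mk β = a

variable {B : Set X}

theorem HasRepIn.refl (hx : x ∈ B) : HasRepIn B (refl x) :=
  ⟨Path.refl x, fun _ => hx, rfl⟩

theorem HasRepIn.symm {a : Path.Homotopic.Quotient x y} (ha : HasRepIn B a) :
    HasRepIn B a.symm := by
  obtain ⟨α, hα, rfl⟩ := ha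
  exact ⟨α.symm, fun t => hα _, rfl⟩

theorem HasRepIn.trans {a : Path.Homotopic.Quotient x y} {b : Path.Homotopic.Quotient y z}
    (ha : HasRepIn B a) (hb : HasRepIn B b) : HasRepIn B (a.trans b) := by
  obtain ⟨α, hα, rfl⟩ := ha
  obtain ⟨β, hβ, rfl⟩ := hb
  refine ⟨α.trans β, fun t => ?_, rfl⟩
  rw [Path.trans_apply]
  split_ifs
  exacts [hα _, hβ _]

theorem HasRepIn.left_mem {a : Path.Homotopic.Quotient x y} (ha : HasRepIn B a) : x ∈ B := by
  obtain ⟨α, hα, -⟩ := ha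
  simpa using hα 0

theorem HasRepIn.right_mem {a : Path.Homotopic.Quotient x y} (ha : HasRepIn B a) : y ∈ B :=
  ha.symm.left_mem

end Path.Homotopic.Quotient

/-! ### Tracks of homotopies and their naturality -/

namespace ContinuousMap.Homotopy

open Path.Homotopic.Quotient

variable {X Y Z : Type*} [TopologicalSpace X] [TopologicalSpace Y] [TopologicalSpace Z]
  {f g h : C(X, Y)}

/-- The homotopy class of the track of a point. -/
def track (F : f.Homotopy g) (x : X) : Path.Homotopic.Quotient (f x) (g x) :=
  Path.Homotopic.Quotient.mk (F.evalAt x)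

theorem map_trans_track (F : f.Homotopy g) {x y : X} (a : Path.Homotopic.Quotient x y) :
    (a.map f).trans (F.track y) = (F.track x).trans (a.map g) := by
  induction a using Path.Homotopic.Quotient.ind with
  | mk α => exact Path.Homotopic.Quotient.eq.mpr (Path.Homotopic.map_trans_evalAt F α)

theorem track_trans (F : f.Homotopy g) (G : g.Homotopy h) (x : X) :
    (F.trans G).track x = (F.track x).trans (G.track x) := by
  refine congrArg Path.Homotopic.Quotient.mk (Path.ext (funext fun t => ?_))
  change (F.trans G) (t, x) = ((F.evalAt x).trans (G.evalAt x)) t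
  rw [trans_apply, Path.trans_apply]
  rfl

theorem track_compContinuousMap (F : f.Homotopy g) (φ : C(Z, X)) (z : Z) :
    (F.compContinuousMap φ).track z = F.track (φ z) := rfl

end ContinuousMap.Homotopy

/-! ### Nielsen classes and essential points -/

namespace NielsenPreimage

open Path.Homotopic.Quotient ContinuousMap

section Classes

variable {X Y : Type*} [TopologicalSpace X] [TopologicalSpace Y] {f f₀ f₁ f₂ : C(X, Y)} {B : Set Y}

/-- The diagonal of the unit square is homotopic to two consecutive edges; the map (s, t) ↦ F (s, α
t) carries this homotopy to `Y`. -/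
theorem mk_diagPath (F : f₀.Homotopy f₁) {x₀ x₁ : X} (α : Path x₀ x₁) :
    Path.Homotopic.Quotient.mk (diagPath F α) = ((Path.Homotopic.Quotient.mk α).map f₀).trans (F.track x₁) := by
  let G : C(unitInterval × unitInterval, Y) :=
    ⟨fun s => F (s.1, α s.2), by fun_prop⟩
  let d : Path ((0, 0) : unitInterval × unitInterval) (1, 1) := Path.prod .id .id
  let a : Path ((0, 0) : unitInterval × unitInterval) (0, 1) := Path.prod (.refl 0) .id
  let b : Path ((0, 1) : unitInterval × unitInterval) (1, 1) := Path.prod .id (.refl 1)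
  have hab : d.Homotopic (a.trans b) := by
    simp only [a, b]
    rw [Path.trans_prod_eq_prod_trans]
    exact ⟨Path.Homotopic.prodHomotopy (Path.Homotopy.reflTrans _).symm
      (Path.Homotopy.transRefl _).symm⟩
  have key := hab.map G
  have h0 : f₀ x₀ = G (0, 0) := by simp [G]
  have h1 : f₁ x₁ = G (1, 1) := by simp [G]
  have key' := key.pathCast h0 h1
  rw [Path.map_trans] at key'
  change _ = Path.Homotopic.Quotient.mk ((α.map f₀.continuous).trans (F.evalAt x₁))
  refine Path.Homotopic.Quotient.eq.mpr ?_
  convert! key' using 1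
  ext t
  simp only [Path.trans_apply, Path.cast_coe]
  split_ifs
  · simp [a, G]
  · exact congrArg (fun x => F (_, x)) α.target.symm

theorem related_iff (F : f₀.Homotopy f₁) {x₀ x₁ : X} :
    Related F B x₀ x₁ ↔
      ∃ a : Path.Homotopic.Quotient x₀ x₁, HasRepIn B ((a.map f₀).trans (F.track x₁)) := by
  constructor
  · rintro ⟨α, β, hβ, h⟩
    exact ⟨Path.Homotopic.Quotient.mk α, β, hβ, by rw [← mk_diagPath, Path.Homotopic.Quotient.eq.mpr h]⟩
  · rintro ⟨a, β, hβ, h⟩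
    induction a using Path.Homotopic.Quotient.ind with
    | mk α => exact ⟨α, β, hβ, Path.Homotopic.Quotient.eq.mp (by rw [h, mk_diagPath])⟩

theorem nielsenEquiv_iff {x₀ x₁ : X} :
    NielsenEquiv f B x₀ x₁ ↔ ∃ a : Path.Homotopic.Quotient x₀ x₁, HasRepIn B (a.map f) := by
  constructor
  · rintro ⟨α, β, hβ, h⟩
    exact ⟨Path.Homotopic.Quotient.mk α, β, hβ, (Path.Homotopic.Quotient.eq.mpr h).symm⟩
  · rintro ⟨a, β, hβ, h⟩
    induction a using Path.Homotopic.Quotient.ind with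
    | mk α => exact ⟨α, β, hβ, Path.Homotopic.Quotient.eq.mp h.symm⟩

theorem NielsenEquiv.refl {x : X} (hx : f x ∈ B) : NielsenEquiv f B x x :=
  nielsenEquiv_iff.mpr ⟨Path.Homotopic.Quotient.refl x, HasRepIn.refl hx⟩

theorem NielsenEquiv.symm {x y : X} (h : NielsenEquiv f B x y) : NielsenEquiv f B y x := by
  obtain ⟨a, ha⟩ := nielsenEquiv_iff.mp h
  exact nielsenEquiv_iff.mpr ⟨a.symm, by rw [Path.Homotopic.Quotient.map_symm]; exact ha.symm⟩

theorem NielsenEquiv.trans {x y z : X} (h : NielsenEquiv f B x y) (h' : NielsenEquiv f B y z) :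
    NielsenEquiv f B x z := by
  obtain ⟨a, ha⟩ := nielsenEquiv_iff.mp h
  obtain ⟨b, hb⟩ := nielsenEquiv_iff.mp h'
  exact nielsenEquiv_iff.mpr ⟨a.trans b, by rw [Path.Homotopic.Quotient.map_trans]; exact ha.trans hb⟩

theorem NielsenEquiv.left_mem {x y : X} (h : NielsenEquiv f B x y) : f x ∈ B := by
  obtain ⟨a, ha⟩ := nielsenEquiv_iff.mp h
  exact ha.left_mem

theorem NielsenEquiv.right_mem {x y : X} (h : NielsenEquiv f B x y) : f y ∈ B :=
  h.symm.left_mem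

theorem Related.right_mem {F : f₀.Homotopy f₁} {x y : X} (h : Related F B x y) : f₁ y ∈ B := by
  obtain ⟨a, ha⟩ := (related_iff F).mp h
  exact ha.right_mem

theorem NielsenEquiv.trans_related {F : f₀.Homotopy f₁} {x y z : X} (h : NielsenEquiv f₀ B x y)
    (h' : Related F B y z) : Related F B x z := by
  obtain ⟨a, ha⟩ := nielsenEquiv_iff.mp h
  obtain ⟨b, hb⟩ := (related_iff F).mp h'
  exact (related_iff F).mpr ⟨a.trans b, by
    rw [Path.Homotopic.Quotient.map_trans, trans_assoc]; exact ha.trans hb⟩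

/-- Two points related to the same point are Nielsen equivalent. -/
theorem Related.nielsenEquiv_left {F : f₀.Homotopy f₁} {x x' y : X} (h : Related F B x y)
    (h' : Related F B x' y) : NielsenEquiv f₀ B x x' := by
  obtain ⟨a, ha⟩ := (related_iff F).mp h
  obtain ⟨b, hb⟩ := (related_iff F).mp h'
  refine nielsenEquiv_iff.mpr ⟨a.trans b.symm, ?_⟩
  rw [Path.Homotopic.Quotient.map_trans, Path.Homotopic.Quotient.map_symm]
  have : (a.map f₀).trans (b.map f₀).symm =
      ((a.map f₀).trans (F.track y)).trans ((b.map f₀).trans (F.track y)).symm := by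
    apply trans_right_cancel ((b.map f₀).trans (F.track y))
    simp only [trans_assoc, symm_trans, trans_refl, symm_trans_trans]
  rw [this]
  exact ha.trans hb.symm

/-- Naturality moves the path from `y` to `z` past the track, turning its `f₀`-image into its
`f₁`-image. -/
theorem Related.trans_nielsenEquiv {F : f₀.Homotopy f₁} {x y z : X} (h : Related F B x y)
    (h' : NielsenEquiv f₁ B y z) : Related F B x z := by
  obtain ⟨a, ha⟩ := (related_iff F).mp h
  obtain ⟨b, hb⟩ := nielsenEquiv_iff.mp h'
  refine (related_iff F).mpr ⟨a.trans b, ?_⟩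
  rw [Path.Homotopic.Quotient.map_trans, trans_assoc, ContinuousMap.Homotopy.map_trans_track, ← trans_assoc]
  exact ha.trans hb

/-- A relation along a concatenated homotopy restricts to one along the second homotopy. -/
theorem Related.of_trans {F : f₀.Homotopy f₁} {G : f₁.Homotopy f₂} {x y z : X}
    (h : Related F B x y) (h' : Related (F.trans G) B x z) : Related G B y z := by
  obtain ⟨a, ha⟩ := (related_iff F).mp h
  obtain ⟨b, hb⟩ := (related_iff _).mp h'
  refine (related_iff G).mpr ⟨a.symm.trans b, ?_⟩
  have : ((a.symm.trans b).map f₁).trans (G.track z) =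
      ((a.map f₀).trans (F.track y)).symm.trans
        ((b.map f₀).trans ((F.trans G).track z)) := by
    apply trans_left_cancel ((a.map f₀).trans (F.track y))
    rw [trans_symm_trans, ContinuousMap.Homotopy.track_trans, trans_assoc,
      ← trans_assoc (F.track y), ← F.map_trans_track, trans_assoc,
      Path.Homotopic.Quotient.map_trans, Path.Homotopic.Quotient.map_symm, trans_assoc,
      trans_symm_trans]
  rw [this]
  exact ha.symm.trans hb

/-- The point `x` lies in an essential Nielsen class. -/
def IsEssentialPoint (f : C(X, Y)) (B : Set Y) (x : X) : Prop :=
  f x ∈ B ∧ ∀ (f₁ : C(X, Y)) (F : f.Homotopy f₁), ∃ x₁, Related F B x x₁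

theorem setOf_nielsenEquiv_eq_iff {x y : X} (hx : f x ∈ B) :
    {z | NielsenEquiv f B x z} = {z | NielsenEquiv f B y z} ↔ NielsenEquiv f B x y := by
  constructor
  · intro h
    have : x ∈ {z | NielsenEquiv f B y z} := h ▸ NielsenEquiv.refl hx
    exact this.symm
  · intro h
    ext z
    exact ⟨h.symm.trans, h.trans⟩

/-- A relation found at any point of the class passes to `x` by prefixing a Nielsen equivalence, so
one point decides for the class. -/
theorem isEssentialClass_setOf_iff {x : X} :
    f x ∈ B ∧ IsEssentialClass f B {z | NielsenEquiv f B x z} ↔ IsEssentialPoint f B x := by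
  constructor
  · rintro ⟨hx, -, h⟩
    refine ⟨hx, fun f₁ F => ?_⟩
    obtain ⟨A₁, -, y, hy, z, -, hyz⟩ := h f₁ F
    exact ⟨z, NielsenEquiv.trans_related hy hyz⟩
  · rintro ⟨hx, h⟩
    refine ⟨hx, ⟨x, hx, rfl⟩, fun f₁ F => ?_⟩
    obtain ⟨z, hz⟩ := h f₁ F
    exact ⟨_, ⟨z, hz.right_mem, rfl⟩, x, NielsenEquiv.refl hx, z, NielsenEquiv.refl hz.right_mem,
      hz⟩

theorem IsEssentialClass.exists_point {A : Set X} (h : IsEssentialClass f B A) :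
    ∃ x, IsEssentialPoint f B x ∧ A = {z | NielsenEquiv f B x z} := by
  obtain ⟨x, hx, rfl⟩ := h.1
  exact ⟨x, isEssentialClass_setOf_iff.mp ⟨hx, h⟩, rfl⟩

theorem IsEssentialPoint.isEssentialClass {x : X} (h : IsEssentialPoint f B x) :
    IsEssentialClass f B {z | NielsenEquiv f B x z} :=
  (isEssentialClass_setOf_iff.mpr h).2

theorem allClassesEssential_iff :
    AllClassesEssential f B ↔ ∀ x, f x ∈ B → IsEssentialPoint f B x := by
  constructor
  · exact fun h x hx => isEssentialClass_setOf_iff.mp ⟨hx, h _ ⟨x, hx, rfl⟩⟩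
  · rintro h A ⟨x, hx, rfl⟩
    exact (h x hx).isEssentialClass

end Classes

/-! ### Comparison of Nielsen numbers -/

section Comparison

variable {X X' Y : Type*} [TopologicalSpace X] [TopologicalSpace X'] [TopologicalSpace Y]
  {B : Set Y}

/-- A map from essential points to essential points that reflects Nielsen equivalence gives an
inequality of Nielsen numbers. -/
theorem nielsenNumber_le_of_map {f : C(X, Y)} {f' : C(X', Y)} (Ψ : X → X')
    (hΨ : ∀ x, IsEssentialPoint f B x → IsEssentialPoint f' B (Ψ x))
    (hinj : ∀ x y, IsEssentialPoint f B x → IsEssentialPoint f B y →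
      NielsenEquiv f' B (Ψ x) (Ψ y) → NielsenEquiv f B x y) :
    nielsenNumber f B ≤ nielsenNumber f' B := by
  have h : ∀ A : {A : Set X | IsEssentialClass f B A}, ∃ x, IsEssentialPoint f B x ∧
    A.1 = {z | NielsenEquiv f B x z} := fun A => A.2.exists_point
  choose r hr hrA using h
  let Θ : {A : Set X | IsEssentialClass f B A} → {A : Set X' | IsEssentialClass f' B A} :=
    fun A => ⟨{z | NielsenEquiv f' B (Ψ (r A)) z}, (hΨ _ (hr A)).isEssentialClass⟩
  have hΘ : Function.Injective Θ := by
    intro A A' h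
    have h1 := (setOf_nielsenEquiv_eq_iff (hΨ _ (hr A)).1).mp (congrArg Subtype.val h)
    apply Subtype.ext
    rw [hrA A, hrA A']
    exact (setOf_nielsenEquiv_eq_iff (hr A).1).mpr (hinj _ _ (hr A) (hr A') h1)
  exact Function.Embedding.encard_le ⟨Θ, hΘ⟩

/-- A point related along `F` to an essential point is itself essential: any homotopy of `f₁` may be
preceded by `F`. -/
theorem nielsenNumber_le_of_homotopy {f₀ f₁ : C(X, Y)} (F : f₀.Homotopy f₁) :
    nielsenNumber f₀ B ≤ nielsenNumber f₁ B := by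
  classical
  -- The default value `x` never occurs at an essential point.
  let Ψ : X → X := fun x => if h : ∃ y, Related F B x y then h.choose else x
  have hΨ : ∀ x, IsEssentialPoint f₀ B x → Related F B x (Ψ x) := by
    intro x hx
    have h := hx.2 f₁ F
    simp only [Ψ, dif_pos h]
    exact h.choose_spec
  refine nielsenNumber_le_of_map Ψ (fun x hx => ⟨(hΨ x hx).right_mem, fun f₂ G => ?_⟩)
    (fun x y hx hy h => ((hΨ x hx).trans_nielsenEquiv h).nielsenEquiv_left (hΨ y hy))
  obtain ⟨z, hz⟩ := hx.2 f₂ (F.trans G)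
  exact ⟨z, (hΨ x hx).of_trans hz⟩

theorem Related.map {f₀ f₁ : C(X', Y)} {F : f₀.Homotopy f₁} {φ : C(X, X')} {x y : X}
    (h : Related (F.compContinuousMap φ) B x y) : Related F B (φ x) (φ y) := by
  obtain ⟨a, ha⟩ := (related_iff _).mp h
  refine (related_iff F).mpr ⟨a.map φ, ?_⟩
  rw [← Path.Homotopic.Quotient.map_comp]
  exact ha

theorem IsEssentialPoint.map {f' : C(X', Y)} {φ : C(X, X')} {x : X}
    (h : IsEssentialPoint (f'.comp φ) B x) : IsEssentialPoint f' B (φ x) := by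
  refine ⟨h.1, fun f₁ F => ?_⟩
  obtain ⟨y, hy⟩ := h.2 _ (F.compContinuousMap φ)
  exact ⟨φ y, hy.map⟩

/-- Paths from `x₀` to `x` and `y` turn `b` into a loop at `φ x₀`, which lifts by surjectivity. -/
theorem exists_map_eq_of_surjective [PathConnectedSpace X] {φ : C(X, X')} {x₀ : X}
    (hφ : Function.Surjective (FundamentalGroup.map φ x₀)) {x y : X}
    (b : Path.Homotopic.Quotient (φ x) (φ y)) :
    ∃ a : Path.Homotopic.Quotient x y, a.map φ = b := by
  let c : Path.Homotopic.Quotient x₀ x := Path.Homotopic.Quotient.mk (PathConnectedSpace.somePath x₀ x)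
  let d : Path.Homotopic.Quotient x₀ y := Path.Homotopic.Quotient.mk (PathConnectedSpace.somePath x₀ y)
  obtain ⟨e, he⟩ := hφ (((c.map φ).trans b).trans (d.map φ).symm)
  change Path.Homotopic.Quotient.map (x₀ := x₀) (x₁ := x₀) e φ = _ at he
  refine ⟨c.symm.trans (Path.Homotopic.Quotient.trans (x₀ := x₀) (x₁ := x₀) e d), ?_⟩
  rw [Path.Homotopic.Quotient.map_trans, Path.Homotopic.Quotient.map_trans, he, Path.Homotopic.Quotient.map_symm]
  simp only [trans_assoc, symm_trans, trans_refl, symm_trans_trans]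

theorem NielsenEquiv.of_map [PathConnectedSpace X] {f' : C(X', Y)} {φ : C(X, X')} {x₀ : X}
    (hφ : Function.Surjective (FundamentalGroup.map φ x₀)) {x y : X}
    (h : NielsenEquiv f' B (φ x) (φ y)) : NielsenEquiv (f'.comp φ) B x y := by
  obtain ⟨b, hb⟩ := nielsenEquiv_iff.mp h
  obtain ⟨a, rfl⟩ := exists_map_eq_of_surjective hφ b
  exact nielsenEquiv_iff.mpr ⟨a, by rw [Path.Homotopic.Quotient.map_comp]; exact hb⟩

theorem nielsenNumber_comp_le [PathConnectedSpace X] (f' : C(X', Y)) {φ : C(X, X')} {x₀ : X}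
    (hφ : Function.Surjective (FundamentalGroup.map φ x₀)) :
    nielsenNumber (f'.comp φ) B ≤ nielsenNumber f' B :=
  nielsenNumber_le_of_map φ (fun _ hx => hx.map) (fun _ _ _ _ h => h.of_map hφ)

/-! ### Right homotopy inverses -/

section RightHomotopyInverse

variable {φ : C(X, X')} {χ : C(X', X)}

/-- The class of the track of `x` under a homotopy from the identity, as a path from `x`. -/
def idTrack (H : (ContinuousMap.id X').Homotopy (φ.comp χ)) (x : X') :
    Path.Homotopic.Quotient x (φ (χ x)) :=
  H.track x

theorem trans_idTrack (H : (ContinuousMap.id X').Homotopy (φ.comp χ)) {x y : X'}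
    (a : Path.Homotopic.Quotient x y) :
    a.trans (idTrack H y) = (idTrack H x).trans ((a.map χ).map φ) := by
  rw [← Path.Homotopic.Quotient.map_comp]
  refine Eq.trans ?_ (H.map_trans_track a)
  rw [Path.Homotopic.Quotient.map_id]
  rfl

/-- Naturality is applied to the track of `x` itself, and that track is then cancelled. -/
theorem idTrack_map (H : (ContinuousMap.id X').Homotopy (φ.comp χ)) (x : X') :
    ((idTrack H x).map χ).map φ = idTrack H (φ (χ x)) :=
  (trans_left_cancel _ (trans_idTrack H (idTrack H x))).symm

theorem exists_map_eq_of_homotopy (H : (ContinuousMap.id X').Homotopy (φ.comp χ)) {x y : X'}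
    (b : Path.Homotopic.Quotient (φ (χ x)) (φ (χ y))) :
    ∃ a : Path.Homotopic.Quotient x y, (a.map χ).map φ = b := by
  refine ⟨((idTrack H x).trans b).trans (idTrack H y).symm, ?_⟩
  apply trans_left_cancel (idTrack H x)
  rw [← trans_idTrack]
  simp only [trans_assoc, symm_trans, trans_refl]

theorem map_surjective_of_homotopy (H : (ContinuousMap.id X').Homotopy (φ.comp χ)) (x : X') :
    Function.Surjective (FundamentalGroup.map φ (χ x)) := fun b =>
  let ⟨a, ha⟩ := exists_map_eq_of_homotopy H (x := x) (y := x) b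
  ⟨a.map χ, ha⟩

/-- A path from `χ x` to `χ y` need not come from `X'`, but its `φ`-image agrees with the φχ-image
of a path from `x` to `y`, and f'φ sees only that image. -/
theorem nielsenEquiv_of_rightInverse (H : (ContinuousMap.id X').Homotopy (φ.comp χ))
    (f' : C(X', Y)) {x y : X'} (h : NielsenEquiv (f'.comp φ) B (χ x) (χ y)) :
    NielsenEquiv ((f'.comp φ).comp χ) B x y := by
  obtain ⟨a, ha⟩ := nielsenEquiv_iff.mp h
  obtain ⟨c, hc⟩ := exists_map_eq_of_homotopy H (a.map φ)
  refine nielsenEquiv_iff.mpr ⟨c, ?_⟩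
  rw [Path.Homotopic.Quotient.map_comp] at ha ⊢
  rw [Path.Homotopic.Quotient.map_comp, hc]
  exact ha

theorem nielsenNumber_le_of_rightInverse (H : (ContinuousMap.id X').Homotopy (φ.comp χ))
    (f' : C(X', Y)) : nielsenNumber f' B ≤ nielsenNumber (f'.comp φ) B :=
  (nielsenNumber_le_of_homotopy ((ContinuousMap.Homotopy.refl f').comp H)).trans
    (nielsenNumber_le_of_map χ (f := (f'.comp φ).comp χ) (fun _ hx => hx.map)
      (fun _ _ _ _ h => nielsenEquiv_of_rightInverse H f' h))

theorem isEssentialPoint_comp_rightInverse (H : (ContinuousMap.id X').Homotopy (φ.comp χ))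
    {f' : C(X', Y)} {g : C(X, Y)} (J : g.Homotopy (f'.comp φ)) {x : X'}
    (hx : IsEssentialPoint g B (χ x)) : IsEssentialPoint (g.comp χ) B x := by
  refine ⟨hx.1, fun h G => ?_⟩
  let M : (f'.comp φ).Homotopy (((f'.comp φ).comp χ).comp φ) :=
    ((ContinuousMap.Homotopy.refl f').comp H).compContinuousMap φ
  -- `K` goes from g to f'φ, then to f'φχφ through `H`, and back along `J` to gχφ.
  let K : g.Homotopy ((g.comp χ).comp φ) :=
    (J.trans M).trans (J.symm.compContinuousMap (χ.comp φ))
  -- The track of `K` at `χ x` is the gχ-image of a path in `X'`, so it can be absorbed into the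
  -- path that relates `x` to a point along `G`.
  have hK : K.track (χ x) = ((idTrack H x).map χ).map g := by
    apply trans_right_cancel (J.track (χ (φ (χ x))))
    have hM : M.track (χ x) = ((idTrack H x).map χ).map (f'.comp φ) := by
      rw [Path.Homotopic.Quotient.map_comp, idTrack_map]
      rfl
    have hKe : K.track (χ x) = ((J.track (χ x)).trans (M.track (χ x))).trans
        (J.track (χ (φ (χ x)))).symm :=
      ((J.trans M).track_trans _ _).trans (congrArg (fun a => a.trans (J.track (χ (φ (χ x)))).symm) (J.track_trans M _))
    rw [J.map_trans_track, ← hM]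
    refine (congrArg (fun a => a.trans (J.track (χ (φ (χ x))))) hKe).trans ?_
    refine (trans_assoc _ _ _).trans ?_
    exact (congrArg _ (symm_trans _)).trans (trans_refl _)
  obtain ⟨y, hy⟩ := hx.2 _ (K.trans (G.compContinuousMap φ))
  obtain ⟨a, ha⟩ := (related_iff _).mp hy
  -- The path in `X'` follows the track from `x` to φχ(x), then the `φ`-image of `a`.
  refine ⟨φ y, (related_iff G).mpr ⟨(idTrack H x).trans (a.map φ), ?_⟩⟩
  rw [ContinuousMap.Homotopy.track_trans, ← trans_assoc, K.map_trans_track, hK,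
    ContinuousMap.Homotopy.track_compContinuousMap,
    Path.Homotopic.Quotient.map_comp (f := φ) (g := g.comp χ)] at ha
  rw [Path.Homotopic.Quotient.map_trans, Path.Homotopic.Quotient.map_comp]
  exact ha

end RightHomotopyInverse

end Comparison

end NielsenPreimage

/-! ### Local homeomorphisms and path lifting -/

namespace IsLocalHomeomorph

theorem locallyPathConnectedSpace {E Y : Type*} [TopologicalSpace E] [TopologicalSpace Y]
    [LocallyPathConnectedSpace Y] {p : E → Y} (hp : IsLocalHomeomorph p) :
    LocallyPathConnectedSpace E := by
  choose c hc _ using hp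
  -- The local homeomorphisms of `p` serve as charts modelled on `Y`.
  let _ : ChartedSpace Y E :=
    { atlas := Set.range c
      chartAt := c
      mem_chart_source := hc
      chart_mem_atlas := fun e => ⟨e, rfl⟩ }
  exact ChartedSpace.locallyPathConnectedSpace Y E

end IsLocalHomeomorph

namespace IsCoveringMap

/-- A path downstairs that is homotopic to the projection of `γ` lifts to a path with the end
points of `γ`. -/
theorem exists_lift_of_homotopic {E Y : Type*} [TopologicalSpace E] [TopologicalSpace Y]
    {p : C(E, Y)} (hp : IsCoveringMap p) {e₀ e₁ : E} (γ : Path e₀ e₁)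
    (β : Path (p e₀) (p e₁)) (h : (γ.map p.continuous).Homotopic β) :
    ∃ Γ : Path e₀ e₁, ∀ t, p (Γ t) = β t := by
  have hγ : (γ : C(unitInterval, E)) =
      hp.liftPath (γ.map p.continuous) e₀ (by simp) :=
    (hp.eq_liftPath_iff' _).mpr ⟨rfl, γ.source⟩
  have h1 := hp.liftPath_apply_one_eq_of_homotopicRel h e₀ (by simp) (by simp)
  refine ⟨⟨hp.liftPath β e₀ (by simp), hp.liftPath_zero _ _ _, ?_⟩,
    fun t => congr_fun (hp.liftPath_lifts β e₀ (by simp)) t⟩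
  exact h1.symm.trans ((DFunLike.congr_fun hγ 1).symm.trans γ.target)

end IsCoveringMap

/-! ### Hopf lifts and R-sets -/

namespace NielsenPreimage

open Path.Homotopic.Quotient ContinuousMap

section Hopf

variable {X Y E : Type*} [TopologicalSpace X] [TopologicalSpace Y] [TopologicalSpace E]
  {f : C(X, Y)} {p : C(E, Y)} {fhat : C(X, E)} {B : Set Y}

theorem IsHopf.comp_eq (h : IsHopf f p fhat) : f = p.comp fhat :=
  ContinuousMap.ext fun x => (h.lift x).symm

theorem IsHopf.locallyPathConnectedSpace [LocallyPathConnectedSpace Y] (h : IsHopf f p fhat) :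
    LocallyPathConnectedSpace E :=
  h.covering.isLocalHomeomorph.locallyPathConnectedSpace

theorem IsHopf.pathConnectedSpace [LocallyPathConnectedSpace Y] (h : IsHopf f p fhat) :
    PathConnectedSpace E := by
  have := h.locallyPathConnectedSpace
  exact pathConnectedSpace_iff_connectedSpace.mpr h.connected

theorem zerothHomotopy_mk_eq_iff {Z : Type*} [TopologicalSpace Z] {x y : Z} :
    ZerothHomotopy.mk x = ZerothHomotopy.mk y ↔ Joined x y :=
  Quotient.eq

theorem IsHopf.exists_loop (h : IsHopf (p.comp fhat) p fhat) {x : X}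
    (c : Path.Homotopic.Quotient (fhat x) (fhat x)) :
    ∃ d : Path.Homotopic.Quotient x x, d.map (p.comp fhat) = c.map p := by
  have hc : FundamentalGroup.mapOfEq p (h.lift x) c ∈
      (FundamentalGroup.map (p.comp fhat) x).range := by
    rw [← h.range_eq x]
    exact ⟨c, rfl⟩
  obtain ⟨d, hd⟩ := hc
  refine ⟨d, hd.trans ?_⟩
  rw [FundamentalGroup.mapOfEq_apply]
  exact cast_rfl_rfl _

/-- Points over `B` are Nielsen equivalent exactly when their Hopf lifts lie in the same path
component of the preimage of `B`. -/
theorem IsHopf.zerothHomotopy_mk_eq_iff [PathConnectedSpace X] (h : IsHopf f p fhat) {x y : X}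
    (hx : fhat x ∈ p ⁻¹' B) (hy : fhat y ∈ p ⁻¹' B) :
    ZerothHomotopy.mk (⟨fhat x, hx⟩ : p ⁻¹' B) = ZerothHomotopy.mk ⟨fhat y, hy⟩ ↔
      NielsenEquiv f B x y := by
  obtain rfl := h.comp_eq
  rw [NielsenPreimage.zerothHomotopy_mk_eq_iff]
  constructor
  · rintro ⟨γ⟩
    let c : Path.Homotopic.Quotient (fhat x) (fhat y) :=
      Path.Homotopic.Quotient.mk (γ.map continuous_subtype_val)
    let a : Path.Homotopic.Quotient x y :=
      Path.Homotopic.Quotient.mk (PathConnectedSpace.somePath x y)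
    -- The lift of `a` may differ from `c` by a loop in `E`; the Hopf condition realises its
    -- projection by a loop `d` in `X`, which corrects `a`.
    obtain ⟨d, hd⟩ := h.exists_loop (c.trans (a.map fhat).symm)
    refine nielsenEquiv_iff.mpr ⟨d.trans a, ?_⟩
    have : (d.trans a).map (p.comp fhat) = c.map p := by
      rw [Path.Homotopic.Quotient.map_trans, hd, Path.Homotopic.Quotient.map_trans,
        Path.Homotopic.Quotient.map_symm, Path.Homotopic.Quotient.map_comp]
      rw [trans_assoc]
      exact (congrArg _ (symm_trans _)).trans (trans_refl _)
    rw [this]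
    exact ⟨(γ.map continuous_subtype_val).map p.continuous, fun t => (γ t).2, rfl⟩
  · rintro ⟨α, β, hβ, hαβ⟩
    obtain ⟨Γ, hΓ⟩ := h.covering.exists_lift_of_homotopic (α.map fhat.continuous) β hαβ
    have hm : ∀ t, Γ t ∈ p ⁻¹' B := fun t => by
      rw [Set.mem_preimage, hΓ]
      exact hβ t
    exact ⟨⟨⟨fun t => ⟨Γ t, hm t⟩, by fun_prop⟩, Subtype.ext Γ.source, Subtype.ext Γ.target⟩⟩

theorem IsHopf.carrier_eq [PathConnectedSpace X] (h : IsHopf f p fhat) {R : RSet p fhat B}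
    {x : X} (hx : x ∈ R.carrier) : R.carrier = {y | NielsenEquiv f B x y} := by
  obtain ⟨hxB, hxR⟩ := hx
  ext y
  constructor
  · rintro ⟨hyB, hyR⟩
    exact (h.zerothHomotopy_mk_eq_iff hxB hyB).mp (hxR.trans hyR.symm)
  · intro hy
    have hyB : fhat y ∈ p ⁻¹' B := by
      have := hy.right_mem
      rwa [← h.lift y] at this
    exact ⟨hyB, ((h.zerothHomotopy_mk_eq_iff hxB hyB).mpr hy).symm.trans hxR⟩

end Hopf

/-! ### The map between R-sets -/

section Comparison

variable {X X' Y E E' : Type*} [TopologicalSpace X] [TopologicalSpace X'] [TopologicalSpace Y]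
  [TopologicalSpace E] [TopologicalSpace E'] {φ : C(X, X')} {f' : C(X', Y)}
  {p : C(E, Y)} {fhat : C(X, E)} {p' : C(E', Y)} {fhat' : C(X', E')} {q : C(E, E')} {B : Set Y}

theorem range_map_comp [PathConnectedSpace X] (f' : C(X', Y)) {x₀ : X}
    (hφ : Function.Surjective (FundamentalGroup.map φ x₀)) (x : X) :
    (FundamentalGroup.map (f'.comp φ) x).range = (FundamentalGroup.map f' (φ x)).range := by
  apply le_antisymm
  · rintro _ ⟨a, rfl⟩
    exact ⟨FundamentalGroup.map φ x a,
      (Path.Homotopic.Quotient.map_comp (x₀ := x) (x₁ := x) (p := a) (f := φ) (g := f')).symm⟩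
  · rintro _ ⟨b, rfl⟩
    obtain ⟨a, rfl⟩ := exists_map_eq_of_surjective hφ (x := x) (y := x) b
    exact ⟨a, Path.Homotopic.Quotient.map_comp⟩

theorem IsHopf.comp [PathConnectedSpace X] {x₀ : X}
    (hφ : Function.Surjective (FundamentalGroup.map φ x₀)) (h : IsHopf f' p' fhat') :
    IsHopf (f'.comp φ) p' (fhat'.comp φ) where
  connected := h.connected
  covering := h.covering
  lift x := h.lift (φ x)
  range_eq x := (h.range_eq (φ x)).trans (range_map_comp f' hφ x).symm

/-- The lifting criterion for a map `p : E → Y` and a covering `p'`, with base points over `y`. -/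
theorem exists_lift_of_range_le [PathConnectedSpace E] [LocallyPathConnectedSpace E]
    (hp' : IsCoveringMap p') {e : E} {e' : E'} {y : Y} (he : p e = y) (he' : p' e' = y)
    (hle : (FundamentalGroup.mapOfEq p he).range ≤ (FundamentalGroup.mapOfEq p' he').range) :
    ∃ q : C(E, E'), q e = e' ∧ ∀ z, p' (q z) = p z := by
  subst he
  have hrange : (FundamentalGroup.map p e).range = (FundamentalGroup.mapOfEq p rfl).range := by
    congr 1
    ext a
    rw [FundamentalGroup.mapOfEq_apply]
    exact (cast_rfl_rfl _).symm
  rw [← hrange] at hle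
  obtain ⟨q, ⟨hqe, hq⟩, -⟩ := hp'.existsUnique_continuousMap_lifts_of_range_le he' hle
  exact ⟨q, hqe, congr_fun hq⟩

/-- The π₁-image of f'φ lies in that of f', so the lifting criterion gives `q`. Lifts agreeing at
one point coincide, which yields both compatibility with the Hopf lifts and uniqueness. -/
theorem IsHopf.existsUnique_isComparison [PathConnectedSpace X] [LocallyPathConnectedSpace Y]
    (x₀ : X) (h : IsHopf (f'.comp φ) p fhat) (h' : IsHopf f' p' fhat') :
    ∃! q : C(E, E'), IsComparison φ p fhat p' fhat' q := by
  have := h.locallyPathConnectedSpace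
  have := h.pathConnectedSpace
  have hle : (FundamentalGroup.mapOfEq p (h.lift x₀)).range ≤
      (FundamentalGroup.mapOfEq p' (h'.lift (φ x₀))).range := by
    rw [h.range_eq, h'.range_eq]
    rintro _ ⟨a, rfl⟩
    exact ⟨FundamentalGroup.map φ x₀ a,
      (Path.Homotopic.Quotient.map_comp (x₀ := x₀) (x₁ := x₀) (p := a) (f := φ) (g := f')).symm⟩
  obtain ⟨q, hq0, hq⟩ := exists_lift_of_range_le h'.covering (h.lift x₀) (h'.lift (φ x₀)) hle
  refine ⟨q, ⟨hq, fun x => ?_⟩, fun q' hq' => ?_⟩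
  · refine congr_fun (h'.covering.eq_of_comp_eq (g₁ := fun x => q (fhat x))
      (g₂ := fun x => fhat' (φ x)) (by fun_prop) (by fun_prop) ?_ x₀ hq0) x
    ext x
    simp only [Function.comp_apply, hq, h.lift, h'.lift]
    rfl
  · refine DFunLike.coe_injective (h'.covering.eq_of_comp_eq q'.continuous q.continuous ?_
      (fhat x₀) ((hq'.lift x₀).trans hq0.symm))
    ext e
    simp only [Function.comp_apply, hq, hq'.proj]

/-- Surjectivity makes the two π₁-images equal, so `p'` also lifts through `p` to a map `r`. By
uniqueness of lifts rq = id, and `r` recovers each path component from its image. -/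
theorem IsComparison.rsetMap_injective [PathConnectedSpace X] [LocallyPathConnectedSpace Y]
    {x₀ : X} (hφ : Function.Surjective (FundamentalGroup.map φ x₀))
    (h : IsHopf (f'.comp φ) p fhat) (h' : IsHopf f' p' fhat')
    (hq : IsComparison φ p fhat p' fhat' q) : Function.Injective (hq.rsetMap B) := by
  have := h'.locallyPathConnectedSpace
  have := h'.pathConnectedSpace
  have := h.pathConnectedSpace
  have hle : (FundamentalGroup.mapOfEq p' (h'.lift (φ x₀))).range ≤
      (FundamentalGroup.mapOfEq p (h.lift x₀)).range := by
    rw [h.range_eq, h'.range_eq]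
    exact (range_map_comp f' hφ x₀).ge
  obtain ⟨r, hr0, hr⟩ := exists_lift_of_range_le h.covering (h'.lift (φ x₀)) (h.lift x₀) hle
  have hrq : ∀ e, r (q e) = e := by
    refine congr_fun (h.covering.eq_of_comp_eq (g₁ := fun e => r (q e)) (g₂ := fun e => e)
      (by fun_prop) (by fun_prop) ?_ (fhat x₀) (by rw [hq.lift, hr0]))
    ext e
    simp only [Function.comp_apply, hr, hq.proj]
  let ρ : C(p' ⁻¹' B, p ⁻¹' B) :=
    ⟨fun e => ⟨r e, by rw [Set.mem_preimage, hr]; exact e.2⟩, by fun_prop⟩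
  have hρ : ∀ e, ρ (hq.restrict B e) = e := fun e => Subtype.ext (hrq e)
  rintro ⟨l₁⟩ ⟨l₂⟩ hl
  induction l₁ using ZerothHomotopy.rec with
  | mk e₁ =>
    induction l₂ using ZerothHomotopy.rec with
    | mk e₂ =>
      have hl' : ZerothHomotopy.mk (hq.restrict B e₁) = ZerothHomotopy.mk (hq.restrict B e₂) :=
        congrArg RSet.label hl
      obtain ⟨γ⟩ := zerothHomotopy_mk_eq_iff.mp hl'
      refine RSet.ext (zerothHomotopy_mk_eq_iff.mpr ⟨?_⟩)
      exact (γ.map ρ.continuous).cast (hρ e₁).symm (hρ e₂).symm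

theorem IsComparison.map_mem_carrier (hq : IsComparison φ p fhat p' fhat' q) {R : RSet p fhat B}
    {x : X} (hx : x ∈ R.carrier) : φ x ∈ (hq.rsetMap B R).carrier := by
  obtain ⟨hxB, hxR⟩ := hx
  obtain ⟨l⟩ := R
  subst hxR
  have hmem : fhat' (φ x) ∈ p' ⁻¹' B := by
    rw [← hq.lift, Set.mem_preimage, hq.proj]
    exact hxB
  refine ⟨hmem, ?_⟩
  change _ = ZerothHomotopy.mk (hq.restrict B ⟨fhat x, hxB⟩)
  congr 1
  exact Subtype.ext (hq.lift x).symm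

/-- An essential class has a point; its `φ`-image is essential and lies in the target R-set, which
is therefore a single Nielsen class. -/
theorem IsComparison.isEssentialClass_rsetMap [PathConnectedSpace X'] (h' : IsHopf f' p' fhat')
    (hq : IsComparison φ p fhat p' fhat' q) {R : RSet p fhat B}
    (hR : IsEssentialClass (f'.comp φ) B R.carrier) :
    IsEssentialClass f' B (hq.rsetMap B R).carrier := by
  obtain ⟨x, hx, hRx⟩ := hR.exists_point
  have hxR : x ∈ R.carrier := by
    rw [hRx]
    exact NielsenEquiv.refl hx.1
  rw [h'.carrier_eq (hq.map_mem_carrier hxR)]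
  exact hx.map.isEssentialClass

end Comparison

end NielsenPreimage

open NielsenPreimage

theorem lemma4p3 {X : Type u} {X' : Type u'} {Y : Type w}
    [TopologicalSpace X] [T2Space X] [ConnectedSpace X] [LocallyPathConnectedSpace X]
    [TopologicalSpace X'] [T2Space X'] [ConnectedSpace X'] [LocallyPathConnectedSpace X']
    [TopologicalSpace Y] [T2Space Y] [ConnectedSpace Y] [LocallyPathConnectedSpace Y]
    (hY : NielsenPreimage.SemilocallySimplyConnected Y) (B : Set Y) (hB : B.Nonempty)
    (f : C(X, Y)) (f' : C(X', Y)) (φ : C(X, X')) (hf : f = f'.comp φ) :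
    -- `φ` is surjective on `π₁` at some base point.
    (∀ x₀ : X, Function.Surjective (FundamentalGroup.map φ x₀) →
      -- a Hopf covering and lift for `f'` give ones for `f`
      (∀ (E' : Type v') [TopologicalSpace E'] (p' : C(E', Y)) (fhat' : C(X', E')),
        NielsenPreimage.IsHopf f' p' fhat' →
          NielsenPreimage.IsHopf f p' (fhat'.comp φ)) ∧
      -- the map of `R`-sets is injective and preserves essential classes
      (∀ (E : Type v) [TopologicalSpace E] (p : C(E, Y)) (fhat : C(X, E))
          (E' : Type v') [TopologicalSpace E'] (p' : C(E', Y)) (fhat' : C(X', E')),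
        NielsenPreimage.IsHopf f p fhat → NielsenPreimage.IsHopf f' p' fhat' →
          (∃! q : C(E, E'), NielsenPreimage.IsComparison φ p fhat p' fhat' q) ∧
          ∀ (q : C(E, E')) (hq : NielsenPreimage.IsComparison φ p fhat p' fhat' q),
            Function.Injective (hq.rsetMap B) ∧
            ∀ R : NielsenPreimage.RSet p fhat B,
              NielsenPreimage.IsEssentialClass f B R.carrier →
                NielsenPreimage.IsEssentialClass f' B (hq.rsetMap B R).carrier) ∧
      NielsenPreimage.nielsenNumber f B ≤ NielsenPreimage.nielsenNumber f' B) ∧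
    -- `χ` is a right homotopy inverse of `φ`.
    (∀ χ : C(X', X), (φ.comp χ).Homotopic (ContinuousMap.id X') →
      (∀ g : C(X, Y), g.Homotopic f → NielsenPreimage.AllClassesEssential g B →
        (g.comp χ).Homotopic f' ∧ NielsenPreimage.AllClassesEssential (g.comp χ) B) ∧
      NielsenPreimage.nielsenNumber f B = NielsenPreimage.nielsenNumber f' B) := by
  subst hf
  have : PathConnectedSpace X := pathConnectedSpace_iff_connectedSpace.mpr inferInstance
  have : PathConnectedSpace X' := pathConnectedSpace_iff_connectedSpace.mpr inferInstance
  refine ⟨fun x₀ hφ => ⟨fun E' _ p' fhat' h => h.comp hφ, ?_, nielsenNumber_comp_le f' hφ⟩, ?_⟩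
  · intro E _ p fhat E' _ p' fhat' h h'
    exact ⟨h.existsUnique_isComparison x₀ h', fun q hq =>
      ⟨hq.rsetMap_injective hφ h h', fun R hR => hq.isEssentialClass_rsetMap h' hR⟩⟩
  · rintro χ hχ
    obtain ⟨H⟩ := hχ.symm
    refine ⟨fun g hg hgB => ⟨?_, ?_⟩, le_antisymm ?_ (nielsenNumber_le_of_rightInverse H f')⟩
    · exact (hg.comp (.refl χ)).trans ((ContinuousMap.Homotopic.refl f').comp hχ)
    · obtain ⟨J⟩ := hg
      rw [allClassesEssential_iff] at hgB ⊢
      exact fun x hx => isEssentialPoint_comp_rightInverse H J (hgB (χ x) hx)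
    · let x' : X' := Classical.arbitrary X'
      exact nielsenNumber_comp_le f' (map_surjective_of_homotopy H x')
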